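/- **Lemma (Oracle Representation Lemma).** Let $L$ be a first-order language with equality containing the symbols $0, S, +, \times$. A *theory* in $L$ is a set $T$ of $L$-sentences closed under logical consequence, and $T \vdash A$ means $A \in T$. *Robinson Arithmetic* $\mathsf{Q}$ is the set of all logical consequences, in the language $\{0,S,+,\times\}$, of the axioms $$\forall x\,\neg\, Sx=0,\quad \forall x,y\,(Sx=Sy\to x=y),\quad \forall x\,(x=0\lor\exists y\,Sy=x),$$ $$\forall x\; x+0=x,\quad \forall x,y\; x+Sy=S(x+y),\quad \forall x\; x\times 0=0,\quad \forall x,y\; x\times Sy=x+(x\times y),$$ and $T$ *extends* $\mathsf{Q}$ if $\mathsf{Q}\subseteq T$. For $n\in\mathbb{N}$ let $\overline{n}$ be the numeral $S\cdots S0$ with $n$ occurrences of $S$. A partial function $h\colon\mathbb{N}^k\rightharpoonup\mathbb{N}$ is *represented* in $T$ if there is an $L$-formula $\rho(a_1,\dots,a_k,b)$ such that whenever $h(x_1,\dots,x_k)$ is defined and equal to $y$, $$T\vdash \bigl(\exists!\,b\;\rho(\overline{x_1},\dots,\overline{x_k},b)\bigr)\land\rho(\overline{x_1},\dots,\overline{x_k},\overline{y}).$$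 Let $T$ be a theory in $L$ that extends $\mathsf{Q}$ and represents a partial function $g\colon\mathbb{N}^m\rightharpoonup\mathbb{N}$. Then $T$ represents every partial function $f\colon\mathbb{N}^k\rightharpoonup\mathbb{N}$ that is computable with oracle access to $g$, i.e. partial recursive relative to $g$ (a computation that queries $g$ outside its domain does not halt). -/

import Mathlib

open FirstOrder FirstOrder.Language

universe u v

namespace OracleRep

/-- The function symbols of arithmetic: `0`, `S`, `+` and `×`. -/
inductive ArithFunc : ℕ → Type
  | zero : ArithFunc 0
  | succ : ArithFunc 1
  | add : ArithFunc 2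
  | mul : ArithFunc 2

/-- The first-order language of arithmetic `{0, S, +, ×}` (equality is a logical symbol). -/
def arith : FirstOrder.Language.{0, 0} where
  Functions := ArithFunc
  Relations := fun _ => Empty

section Terms

variable {α : Type*}

/-- The term `0`. -/
def zeroT : arith.Term α := Constants.term (L := arith) ArithFunc.zero

/-- The term `S t`. -/
def succT (t : arith.Term α) : arith.Term α := Functions.apply₁ (L := arith) ArithFunc.succ t

/-- The term `s + t`. -/
def addT (s t : arith.Term α) : arith.Term α := Functions.apply₂ (L := arith) ArithFunc.add s t

/-- The term `s × t`. -/
def mulT (s t : arith.Term α) : arith.Term α := Functions.apply₂ (L := arith) ArithFunc.mul s t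

/-- The numeral `S … S 0` of `n`, with `n` occurrences of `S`. -/
def numeral : ℕ → arith.Term α
  | 0 => zeroT
  | n + 1 => succT (numeral n)

end Terms

/-- `∀ x, ¬ S x = 0` -/
def axS0 : arith.Sentence := ∀' ∼((succT &0) =' zeroT)

/-- `∀ x y, S x = S y → x = y` -/
def axS1 : arith.Sentence := ∀' ∀' (((succT &0) =' (succT &1)) ⟹ (&0 =' &1))

/-- `∀ x, x = 0 ∨ ∃ y, S y = x` -/
def axS2 : arith.Sentence := ∀' ((&0 =' zeroT) ⊔ ∃' ((succT &1) =' &0))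

/-- `∀ x, x + 0 = x` -/
def axA0 : arith.Sentence := ∀' ((addT &0 zeroT) =' &0)

/-- `∀ x y, x + S y = S (x + y)` -/
def axA1 : arith.Sentence := ∀' ∀' ((addT &0 (succT &1)) =' (succT (addT &0 &1)))

/-- `∀ x, x × 0 = 0` -/
def axM0 : arith.Sentence := ∀' ((mulT &0 zeroT) =' zeroT)

/-- `∀ x y, x × S y = x + (x × y)` -/
def axM1 : arith.Sentence := ∀' ∀' ((mulT &0 (succT &1)) =' (addT &0 (mulT &0 &1)))

/-- A set of sentences is a (deductively closed) theory if it contains all its logical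
consequences. For such `T`, "`T` proves `A`" means `A ∈ T`. -/
def IsClosedTheory {L : FirstOrder.Language.{u, v}} (T : L.Theory) : Prop :=
  ∀ A : L.Sentence, T ⊨ᵇ A → A ∈ T

/-- The axioms of Robinson Arithmetic. -/
def robinsonAxioms : arith.Theory := {axS0, axS1, axS2, axA0, axA1, axM0, axM1}

/-- Robinson Arithmetic `Q`: the set of all logical consequences of its axioms. -/
def robinsonQ : arith.Theory := {A | robinsonAxioms ⊨ᵇ A}

/-- `T`, a set of sentences of a language `L` into which the language of arithmetic is mapped by
`ι`, extends `Q`: every theorem of `Q` (read in `L` through `ι`) belongs to `T`. -/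
def ExtendsQ {L : FirstOrder.Language.{u, v}} (ι : arith →ᴸ L) (T : L.Theory) : Prop :=
  ι.onTheory robinsonQ ⊆ T

/-- The formula `ρ` represents the partial function `f : ℕᵏ ⇀ ℕ` in `T`: whenever `f(x) = y`, `T`
proves `∃! y, ρ(x̄, y)` and `ρ(x̄, ȳ)`, where `x̄`, `ȳ` are numerals. The variables `0, …, k-1` of
`ρ` are the inputs and its variable `k` is the output. -/
def RepresentedBy {L : FirstOrder.Language.{u, v}} (ι : arith →ᴸ L) (T : L.Theory) {k : ℕ}
    (f : (Fin k → ℕ) →. ℕ) (ρ : L.Formula (Fin (k + 1))) : Prop :=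
  ∀ (x : Fin k → ℕ) (y : ℕ), y ∈ f x →
    ((Formula.iExsUnique Unit
        (ρ.subst (Fin.snoc (α := fun _ => L.Term (Empty ⊕ Unit))
          (fun i => ι.onTerm (numeral (x i))) (Term.var (Sum.inr ())))) ⊓
      ρ.subst (Fin.snoc (α := fun _ => L.Term Empty)
        (fun i => ι.onTerm (numeral (x i))) (ι.onTerm (numeral y))) : L.Sentence)) ∈ T

/-- The partial function `f : ℕᵏ ⇀ ℕ` is represented in `T`. -/
def Represents {L : FirstOrder.Language.{u, v}} (ι : arith →ᴸ L) (T : L.Theory) {k : ℕ}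
    (f : (Fin k → ℕ) →. ℕ) : Prop :=
  ∃ ρ : L.Formula (Fin (k + 1)), RepresentedBy ι T f ρ

/-- A partial function `g : ℕᵐ ⇀ ℕ` as a unary oracle, through the standard primitive recursive
coding of tuples (the same coding that `RecursiveIn` uses for the inputs). -/
def oracleOf {m : ℕ} (g : (Fin m → ℕ) →. ℕ) : ℕ →. ℕ :=
  fun n => (@Encodable.decode (Fin m → ℕ) Primcodable.toEncodable n : Part (Fin m → ℕ)).bind g

/-- `f : ℕᵏ ⇀ ℕ` is computable with oracle access to `g : ℕᵐ ⇀ ℕ`, that is, partial recursive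
relative to `g`. A query outside the domain of `g` is never answered. -/
def ComputableWithOracle {k m : ℕ} (f : (Fin k → ℕ) →. ℕ) (g : (Fin m → ℕ) →. ℕ) : Prop :=
  RecursiveIn {oracleOf g} f

end OracleRep

/-! The argument is semantic. As `T` is deductively closed, membership in `T` is truth in all models
of `T`. So a formula represents `f` iff, in every model, at the numerals of any `x` in the domain of
`f`, it holds of an arbitrary, possibly nonstandard, element exactly when that element is the
numeral of `f x` (`represents_iff`). This property, with one formula serving all models, is
inherited along the clauses that generate the functions recursive in `g`
(`UnifRepr.of_recursiveIn`).

Robinson arithmetic has no induction, so the difficulty is to exclude nonstandard elements. Two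
facts suffice: elements below a numeral are numerals (`le_num`), and every element is comparable
with every numeral (`le_num_or_num_lt`). Hence a least witness that is a numeral is the only least
witness (`isMinOf_unique`). This settles unbounded search. It also settles primitive recursion,
where the values are coded by a beta function defined as a least remainder: even if the code is
nonstandard, induction on standard indices forces the right values (`precRel_iff`). The coding of
tuples is primitive recursive, hence already represented, and this reduces all arities to the unary
case. -/

namespace OracleRep

/-! ### Numerals, order, pairing and the beta function in models of Robinson arithmetic. -/

section RobinsonModels

variable {M : Type*} [arith.Structure M]

instance : Zero M := ⟨Structure.funMap (L := arith) ArithFunc.zero ![]⟩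

instance : Add M := ⟨fun x y => Structure.funMap (L := arith) ArithFunc.add ![x, y]⟩

instance : Mul M := ⟨fun x y => Structure.funMap (L := arith) ArithFunc.mul ![x, y]⟩

/-- The interpretation of the successor symbol. -/
def sc (x : M) : M := Structure.funMap (L := arith) ArithFunc.succ ![x]

/-- The interpretation of a numeral. -/
def num (M : Type*) [arith.Structure M] : ℕ → M
  | 0 => 0
  | n + 1 => sc (num M n)

section Terms

variable {α : Type*} (v : α → M)

lemma realize_zeroT : (zeroT : arith.Term α).realize v = 0 := by
  refine (Term.realize_constants (L := arith)).trans ?_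
  exact congrArg (Structure.funMap (L := arith) ArithFunc.zero) (Subsingleton.elim _ _)

lemma realize_succT (t : arith.Term α) : (succT t).realize v = sc (t.realize v) :=
  Term.realize_functions_apply₁

lemma realize_addT (s t : arith.Term α) :
    (addT s t).realize v = s.realize v + t.realize v :=
  Term.realize_functions_apply₂

lemma realize_mulT (s t : arith.Term α) :
    (mulT s t).realize v = s.realize v * t.realize v :=
  Term.realize_functions_apply₂

lemma realize_numeral (n : ℕ) : (numeral n : arith.Term α).realize v = num M n := by
  induction n with
  | zero => exact realize_zeroT v
  | succ n ih => rw [numeral, realize_succT, ih, num]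

end Terms

/-- The order of arithmetic: `x ≤ y` iff `z + x = y` for some `z`. -/
def Le (x y : M) : Prop := ∃ z, z + x = y

/-- The strict order of arithmetic. -/
def Lt (x y : M) : Prop := Le (sc x) y

/-- The graph of `Nat.pair`. -/
def PairRel (x y z : M) : Prop :=
  (Lt x y ∧ z = y * y + x) ∨ (¬ Lt x y ∧ z = x * x + x + y)

/-- The graph of the first component of `Nat.unpair`. -/
def LeftRel (x y : M) : Prop := Le y x ∧ ∃ z, Le z x ∧ PairRel y z x

/-- The graph of the second component of `Nat.unpair`. -/
def RightRel (x y : M) : Prop := Le y x ∧ ∃ z, Le z x ∧ PairRel z y x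

/-- `w` is the remainder of `x` modulo `(i + 1) * y + 1`. -/
def ModRel (x y i w : M) : Prop :=
  Lt w (sc (sc i * y)) ∧ ∃ q, Le q x ∧ x = q * sc (sc i * y) + w

/-- `x` is the least element satisfying `P`. -/
def IsMinOf (P : M → Prop) (x : M) : Prop := P x ∧ ∀ y, Lt y x → ¬ P y

/-- Gödel's beta function. -/
def BetaRel (x y i w : M) : Prop := IsMinOf (ModRel x y i) w

/-- `M` satisfies the axioms of Robinson arithmetic. -/
class Robinson (M : Type*) [arith.Structure M] : Prop where
  sc_ne_zero : ∀ x : M, sc x ≠ 0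
  sc_inj : ∀ {x y : M}, sc x = sc y → x = y
  eq_zero_or : ∀ x : M, x = 0 ∨ ∃ y, sc y = x
  add_zero' : ∀ x : M, x + 0 = x
  add_sc : ∀ x y : M, x + sc y = sc (x + y)
  mul_zero' : ∀ x : M, x * 0 = 0
  mul_sc : ∀ x y : M, x * sc y = x + x * y

open Robinson

lemma robinson_of_models (h : M ⊨ robinsonAxioms) : Robinson M := by
  simp only [robinsonAxioms, Theory.model_iff, Set.mem_insert_iff, Set.mem_singleton_iff,
    forall_eq_or_imp, forall_eq, axS0, axS1, axS2, axA0, axA1, axM0, axM1, Sentence.Realize,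
    Formula.Realize, BoundedFormula.realize_all, BoundedFormula.realize_not,
    BoundedFormula.realize_imp, BoundedFormula.realize_sup, BoundedFormula.realize_ex,
    BoundedFormula.realize_bdEqual, realize_zeroT, realize_succT, realize_addT,
    realize_mulT] at h
  obtain ⟨h1, h2, h3, h4, h5, h6, h7⟩ := h
  exact ⟨h1, h2 _ _, h3, h4, h5, h6, h7⟩

variable [Robinson M]

@[simp] lemma num_add (a b : ℕ) : num M (a + b) = num M a + num M b := by
  induction b with
  | zero => exact (add_zero' _).symm
  | succ b ih => rw [← add_assoc, num, ih, num, add_sc]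

@[simp] lemma num_mul (a b : ℕ) : num M (a * b) = num M a * num M b := by
  induction b with
  | zero => exact (mul_zero' _).symm
  -- The sum is commuted in `ℕ`, since addition in `M` need not be commutative.
  | succ b ih => rw [Nat.mul_succ, Nat.add_comm, num_add, ih, num, mul_sc]

lemma num_injective : Function.Injective (num M) := by
  intro a
  induction a with
  | zero =>
    rintro (_ | b) h
    · rfl
    · exact absurd h.symm (sc_ne_zero _)
  | succ a ih =>
    rintro (_ | b) h
    · exact absurd h (sc_ne_zero _)
    · rw [ih (sc_inj h)]

@[simp] lemma num_inj {a b : ℕ} : num M a = num M b ↔ a = b := num_injective.eq_iff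

/-- Induction on `n`. `Le` puts `x` on the right of the sum, where the addition axioms recurse, so a
successor can be cancelled from both sides. -/
lemma le_num {x : M} {n : ℕ} : Le x (num M n) ↔ ∃ k ≤ n, x = num M k := by
  constructor
  · rintro ⟨z, hz⟩
    induction n generalizing x with
    | zero =>
      rcases eq_zero_or x with rfl | ⟨y, rfl⟩
      · exact ⟨0, le_rfl, rfl⟩
      · exact absurd ((add_sc z y).symm.trans hz) (sc_ne_zero _)
    | succ n ih =>
      rcases eq_zero_or x with rfl | ⟨y, rfl⟩
      · exact ⟨0, Nat.zero_le _, rfl⟩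
      · obtain ⟨k, hk, rfl⟩ := ih (sc_inj ((add_sc z y).symm.trans hz))
        exact ⟨k + 1, Nat.succ_le_succ hk, rfl⟩
  · rintro ⟨k, hk, rfl⟩
    exact ⟨num M (n - k), by rw [← num_add, Nat.sub_add_cancel hk]⟩

lemma lt_num {x : M} {n : ℕ} : Lt x (num M n) ↔ ∃ k < n, x = num M k := by
  rw [Lt, le_num]
  constructor
  · rintro ⟨_ | k, hk, h⟩
    · exact absurd h (sc_ne_zero _)
    · exact ⟨k, hk, sc_inj h⟩
  · rintro ⟨k, hk, rfl⟩
    exact ⟨k + 1, hk, rfl⟩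

@[simp] lemma num_le_num {a b : ℕ} : Le (num M a) (num M b) ↔ a ≤ b := by
  simp [le_num]

@[simp] lemma num_lt_num {a b : ℕ} : Lt (num M a) (num M b) ↔ a < b := by
  simp [lt_num]

lemma le_num_or_num_lt (x : M) (n : ℕ) : Le x (num M n) ∨ Lt (num M n) x := by
  induction n generalizing x with
  | zero =>
    rcases eq_zero_or x with rfl | ⟨y, rfl⟩
    · exact .inl ⟨_, add_zero' _⟩
    · exact .inr ⟨y, by rw [add_sc, num, add_zero']⟩
  | succ n ih =>
    rcases eq_zero_or x with rfl | ⟨y, rfl⟩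
    · exact .inl ⟨_, add_zero' _⟩
    · rcases ih y with ⟨z, hz⟩ | ⟨z, hz⟩
      · exact .inl ⟨z, by rw [add_sc, hz, num]⟩
      · exact .inr ⟨z, by rw [add_sc, num, hz]⟩

/-- A second least element is comparable with the numeral, and the smaller of the two would
contradict the minimality of the other. Nothing is assumed about `P` at nonstandard elements. -/
lemma isMinOf_unique {P : M → Prop} {n : ℕ} (h : IsMinOf P (num M n)) {x : M} :
    IsMinOf P x ↔ x = num M n := by
  refine ⟨fun hx => ?_, by rintro rfl; exact h⟩
  rcases le_num_or_num_lt x n with hle | hlt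
  · obtain ⟨k, hk, rfl⟩ := le_num.1 hle
    rcases hk.lt_or_eq with hk | rfl
    · exact absurd hx.1 (h.2 _ (num_lt_num.2 hk))
    · rfl
  · exact absurd h.1 (hx.2 _ hlt)

lemma isMinOf_iff {P : M → Prop} {n : ℕ} (hn : P (num M n))
    (h : ∀ k < n, ¬ P (num M k)) {x : M} : IsMinOf P x ↔ x = num M n := by
  refine isMinOf_unique ⟨hn, fun y hy => ?_⟩
  obtain ⟨k, hk, rfl⟩ := lt_num.1 hy
  exact h k hk

lemma pairRel_iff {a b : ℕ} {x : M} :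
    PairRel (num M a) (num M b) x ↔ x = num M (Nat.pair a b) := by
  by_cases h : a < b <;> simp [PairRel, Nat.pair, h]

/-- The bounds in `LeftRel` confine both components to numerals, where injectivity of `Nat.pair`
applies. -/
lemma leftRel_iff {n : ℕ} {x : M} : LeftRel (num M n) x ↔ x = num M n.unpair.1 := by
  constructor
  · rintro ⟨h, z, hz, hp⟩
    obtain ⟨a, -, rfl⟩ := le_num.1 h
    obtain ⟨b, -, rfl⟩ := le_num.1 hz
    rw [pairRel_iff, num_inj] at hp
    rw [hp, Nat.unpair_pair]
  · rintro rfl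
    exact ⟨num_le_num.2 (Nat.unpair_left_le n), _, num_le_num.2 (Nat.unpair_right_le n),
      pairRel_iff.2 (by rw [Nat.pair_unpair])⟩

lemma rightRel_iff {n : ℕ} {x : M} : RightRel (num M n) x ↔ x = num M n.unpair.2 := by
  constructor
  · rintro ⟨h, z, hz, hp⟩
    obtain ⟨a, -, rfl⟩ := le_num.1 h
    obtain ⟨b, -, rfl⟩ := le_num.1 hz
    rw [pairRel_iff, num_inj] at hp
    rw [hp, Nat.unpair_pair]
  · rintro rfl
    exact ⟨num_le_num.2 (Nat.unpair_right_le n), _, num_le_num.2 (Nat.unpair_left_le n),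
      pairRel_iff.2 (by rw [Nat.pair_unpair])⟩

lemma modRel_iff {a b i w : ℕ} :
    ModRel (num M a) (num M b) (num M i) (num M w) ↔ w = a % ((i + 1) * b + 1) := by
  have key : sc (sc (num M i) * num M b) = num M ((i + 1) * b + 1) := by
    simp only [num, num_mul]
  rw [ModRel, key, num_lt_num]
  constructor
  · rintro ⟨hw, q, hq, h⟩
    obtain ⟨q, -, rfl⟩ := le_num.1 hq
    rw [← num_mul, ← num_add, num_inj] at h
    rw [h, Nat.mul_add_mod_self_right, Nat.mod_eq_of_lt hw]
  · rintro rfl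
    refine ⟨Nat.mod_lt _ (Nat.succ_pos _), num M (a / ((i + 1) * b + 1)),
      num_le_num.2 (Nat.div_le_self _ _), ?_⟩
    rw [← num_mul, ← num_add, Nat.div_add_mod']

/-- At numerals the remainder is already unique among numerals. Minimality excludes nonstandard
values, and in `precRel_iff` it also controls nonstandard codes. -/
lemma betaRel_iff {a b i : ℕ} {x : M} :
    BetaRel (num M a) (num M b) (num M i) x ↔ x = num M (Nat.beta (Nat.pair a b) i) := by
  refine isMinOf_iff (modRel_iff.2 (by simp [Nat.beta])) fun k hk h => ?_
  rw [modRel_iff] at h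
  simp [Nat.beta, ← h] at hk

end RobinsonModels

/-! ### Definability by one formula across a family of structures. -/

section Definability

variable {L : FirstOrder.Language.{u, v}} {I : Type*} {𝓜 : I → Type*} [∀ i, L.Structure (𝓜 i)]
  {α β : Type*}

variable (L) in
/-- A family of predicates on the structures `𝓜 i` defined by one and the same formula. -/
def UnifDef (P : ∀ i, (α → 𝓜 i) → Prop) : Prop :=
  ∃ φ : L.Formula α, ∀ i v, φ.Realize v ↔ P i v

variable (L) in
/-- A family of functions on the structures `𝓜 i` given by one and the same term. -/
def UnifTerm (t : ∀ i, (α → 𝓜 i) → 𝓜 i) : Prop :=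
  ∃ s : L.Term α, ∀ i v, s.realize v = t i v

namespace UnifDef

variable {P Q : ∀ i, (α → 𝓜 i) → Prop}

lemma not (hP : UnifDef L P) : UnifDef L fun i v => ¬ P i v := by
  obtain ⟨φ, hφ⟩ := hP
  exact ⟨φ.not, fun i v => by rw [Formula.realize_not, hφ]⟩

lemma and (hP : UnifDef L P) (hQ : UnifDef L Q) : UnifDef L fun i v => P i v ∧ Q i v := by
  obtain ⟨φ, hφ⟩ := hP
  obtain ⟨ψ, hψ⟩ := hQ
  exact ⟨φ ⊓ ψ, fun i v => by rw [Formula.realize_inf, hφ, hψ]⟩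

lemma or (hP : UnifDef L P) (hQ : UnifDef L Q) : UnifDef L fun i v => P i v ∨ Q i v := by
  obtain ⟨φ, hφ⟩ := hP
  obtain ⟨ψ, hψ⟩ := hQ
  exact ⟨φ ⊔ ψ, fun i v => by rw [Formula.realize_sup, hφ, hψ]⟩

lemma imp (hP : UnifDef L P) (hQ : UnifDef L Q) : UnifDef L fun i v => P i v → Q i v := by
  obtain ⟨φ, hφ⟩ := hP
  obtain ⟨ψ, hψ⟩ := hQ
  exact ⟨φ.imp ψ, fun i v => by rw [Formula.realize_imp, hφ, hψ]⟩

lemma exists_fun [Finite β] {R : ∀ i, (α → 𝓜 i) → (β → 𝓜 i) → Prop}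
    (hR : UnifDef L fun i (w : α ⊕ β → 𝓜 i) => R i (fun a => w (.inl a)) fun b => w (.inr b)) :
    UnifDef L fun i v => ∃ x, R i v x := by
  obtain ⟨φ, hφ⟩ := hR
  exact ⟨φ.iExs β, fun i v => by simp [Formula.realize_iExs, hφ]⟩

lemma exists' {R : ∀ i, (α → 𝓜 i) → 𝓜 i → Prop}
    (hR : UnifDef L fun i (w : α ⊕ Unit → 𝓜 i) => R i (fun a => w (.inl a)) (w (.inr ()))) :
    UnifDef L fun i v => ∃ x, R i v x := by
  obtain ⟨φ, hφ⟩ := exists_fun (R := fun i v (x : Unit → 𝓜 i) => R i v (x ())) hR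
  exact ⟨φ, fun i v => (hφ i v).trans ⟨fun ⟨x, h⟩ => ⟨_, h⟩, fun ⟨x, h⟩ => ⟨fun _ => x, h⟩⟩⟩

lemma forall' {R : ∀ i, (α → 𝓜 i) → 𝓜 i → Prop}
    (hR : UnifDef L fun i (w : α ⊕ Unit → 𝓜 i) => R i (fun a => w (.inl a)) (w (.inr ()))) :
    UnifDef L fun i v => ∀ x, R i v x := by
  obtain ⟨φ, hφ⟩ := (exists' (R := fun i v x => ¬ R i v x) hR.not).not
  exact ⟨φ, fun i v => by simp [hφ]⟩

lemma forall_fin [Finite β] {R : β → ∀ i, (α → 𝓜 i) → Prop} (hR : ∀ b, UnifDef L (R b)) :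
    UnifDef L fun i v => ∀ b, R b i v := by
  choose φ hφ using hR
  exact ⟨Formula.iInf φ, fun i v => by simp [hφ]⟩

lemma eq {s t : ∀ i, (α → 𝓜 i) → 𝓜 i} (hs : UnifTerm L s) (ht : UnifTerm L t) :
    UnifDef L fun i v => s i v = t i v := by
  obtain ⟨s, hs⟩ := hs
  obtain ⟨t, ht⟩ := ht
  exact ⟨s.equal t, fun i v => by rw [Formula.realize_equal, hs, ht]⟩

lemma subst (hP : UnifDef L P) {t : α → ∀ i, (β → 𝓜 i) → 𝓜 i} (ht : ∀ a, UnifTerm L (t a)) :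
    UnifDef L fun i v => P i fun a => t a i v := by
  obtain ⟨φ, hφ⟩ := hP
  choose s hs using ht
  refine ⟨φ.subst s, fun i v => ?_⟩
  simp only [← hφ, ← hs]
  exact BoundedFormula.realize_subst

/-- Substitution of terms into a uniformly definable binary relation. -/
lemma subst₂ {R : ∀ i, 𝓜 i → 𝓜 i → Prop}
    (hR : UnifDef L fun i (v : Fin 2 → 𝓜 i) => R i (v 0) (v 1)) {s t : ∀ i, (α → 𝓜 i) → 𝓜 i}
    (hs : UnifTerm L s) (ht : UnifTerm L t) : UnifDef L fun i v => R i (s i v) (t i v) :=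
  hR.subst (t := ![s, t]) (Fin.forall_fin_two.2 ⟨hs, ht⟩)

end UnifDef

namespace UnifTerm

variable {s t : ∀ i, (α → 𝓜 i) → 𝓜 i}

lemma var (a : α) : UnifTerm L fun i (v : α → 𝓜 i) => v a := ⟨.var a, fun _ _ => rfl⟩

variable [∀ i, arith.Structure (𝓜 i)] (ι : arith →ᴸ L) [∀ i, ι.IsExpansionOn (𝓜 i)]
include ι

lemma zero : UnifTerm L fun i (_ : α → 𝓜 i) => (0 : 𝓜 i) :=
  ⟨ι.onTerm zeroT, fun _ _ => by rw [LHom.realize_onTerm, realize_zeroT]⟩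

lemma succ (ht : UnifTerm L t) : UnifTerm L fun i v => sc (t i v) := by
  obtain ⟨t, ht⟩ := ht
  refine ⟨(ι.onTerm (succT (.var ()))).subst fun _ => t, fun i v => ?_⟩
  rw [Term.realize_subst, LHom.realize_onTerm, realize_succT, Term.realize_var, ht]

lemma add (hs : UnifTerm L s) (ht : UnifTerm L t) : UnifTerm L fun i v => s i v + t i v := by
  obtain ⟨s, hs⟩ := hs
  obtain ⟨t, ht⟩ := ht
  refine ⟨(ι.onTerm (addT (.var 0) (.var 1))).subst ![s, t], fun i v => ?_⟩
  simp only [← hs, ← ht]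
  rw [Term.realize_subst, LHom.realize_onTerm, realize_addT]
  rfl

lemma mul (hs : UnifTerm L s) (ht : UnifTerm L t) : UnifTerm L fun i v => s i v * t i v := by
  obtain ⟨s, hs⟩ := hs
  obtain ⟨t, ht⟩ := ht
  refine ⟨(ι.onTerm (mulT (.var 0) (.var 1))).subst ![s, t], fun i v => ?_⟩
  simp only [← hs, ← ht]
  rw [Term.realize_subst, LHom.realize_onTerm, realize_mulT]
  rfl

lemma num (n : ℕ) : UnifTerm L fun i (_ : α → 𝓜 i) => num (𝓜 i) n := by
  induction n with
  | zero => exact zero ι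
  | succ n ih => exact succ ι ih

end UnifTerm

namespace UnifDef

variable [∀ i, arith.Structure (𝓜 i)] (ι : arith →ᴸ L) [∀ i, ι.IsExpansionOn (𝓜 i)]
  {s t r q : ∀ i, (α → 𝓜 i) → 𝓜 i}

include ι

lemma le (hs : UnifTerm L s) (ht : UnifTerm L t) : UnifDef L fun i v => Le (s i v) (t i v) :=
  subst₂ (R := fun i => Le (M := 𝓜 i))
    (exists' (eq (.add ι (.var _) (.var _)) (.var _))) hs ht

lemma lt (hs : UnifTerm L s) (ht : UnifTerm L t) : UnifDef L fun i v => Lt (s i v) (t i v) :=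
  le ι (.succ ι hs) ht

lemma pairRel (hs : UnifTerm L s) (ht : UnifTerm L t) (hr : UnifTerm L r) :
    UnifDef L fun i v => PairRel (s i v) (t i v) (r i v) :=
  or (and (lt ι hs ht) (eq hr (.add ι (.mul ι ht ht) hs)))
    (and (not (lt ι hs ht)) (eq hr (.add ι (.add ι (.mul ι hs hs) hs) ht)))

lemma leftRel (hs : UnifTerm L s) (ht : UnifTerm L t) :
    UnifDef L fun i v => LeftRel (s i v) (t i v) :=
  subst₂ (R := fun i => LeftRel (M := 𝓜 i)) (and (le ι (.var _) (.var _))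
    (exists' (and (le ι (.var _) (.var _)) (pairRel ι (.var _) (.var _) (.var _))))) hs ht

lemma rightRel (hs : UnifTerm L s) (ht : UnifTerm L t) :
    UnifDef L fun i v => RightRel (s i v) (t i v) :=
  subst₂ (R := fun i => RightRel (M := 𝓜 i)) (and (le ι (.var _) (.var _))
    (exists' (and (le ι (.var _) (.var _)) (pairRel ι (.var _) (.var _) (.var _))))) hs ht

lemma isMinOf {P : ∀ i, (α → 𝓜 i) → 𝓜 i → Prop}
    (hP : UnifDef L fun i (w : α ⊕ Unit → 𝓜 i) => P i (fun a => w (.inl a)) (w (.inr ())))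
    (ht : UnifTerm L t) : UnifDef L fun i v => IsMinOf (P i v) (t i v) := by
  have key : UnifDef L fun i (w : α ⊕ Unit → 𝓜 i) =>
      IsMinOf (P i fun a => w (.inl a)) (w (.inr ())) := by
    refine and hP (forall' (imp (lt ι (.var _) (.var _)) (not ?_)))
    -- The renaming skips the candidate minimum, so that `P` is applied to the smaller element.
    exact hP.subst (t := fun c i w => w (Sum.map Sum.inl id c)) fun _ => .var _
  exact key.subst (t := Sum.elim (fun a i w => w a) fun _ => t)
    (Sum.rec (fun a => .var _) fun _ => ht)

lemma betaRel (hs : UnifTerm L s) (ht : UnifTerm L t) (hr : UnifTerm L r) (hq : UnifTerm L q) :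
    UnifDef L fun i v => BetaRel (s i v) (t i v) (r i v) (q i v) := by
  have key : UnifDef L fun i (v : Fin 4 → 𝓜 i) => BetaRel (v 0) (v 1) (v 2) (v 3) := by
    refine isMinOf (P := fun i v => ModRel (v 0) (v 1) (v 2)) ι ?_ (.var _)
    refine and (lt ι (.var _) (.succ ι (.mul ι (.succ ι (.var _)) (.var _))))
      (exists' (and (le ι (.var _) (.var _)) (eq (.var _) (.add ι (.mul ι (.var _)
        (.succ ι (.mul ι (.succ ι (.var _)) (.var _)))) (.var _)))))
  exact key.subst (t := ![s, t, r, q]) (by simp [Fin.forall_fin_succ, hs, ht, hr, hq])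

end UnifDef

end Definability

/-! ### Primitive recursion through coded sequences of values. -/

lemma exists_seq_of_mem_rec {f h : ℕ →. ℕ} {a n y : ℕ}
    (hy : y ∈ (n.rec (f a) fun y IH => do
      let i ← IH
      h (Nat.pair a (Nat.pair y i)) : Part ℕ)) :
    ∃ s : ℕ → ℕ, s 0 ∈ f a ∧ (∀ i < n, s (i + 1) ∈ h (Nat.pair a (Nat.pair i (s i)))) ∧
      s n = y := by
  induction n generalizing y with
  | zero => exact ⟨fun _ => y, hy, by simp, rfl⟩
  | succ n ih =>
    obtain ⟨z, hz, hy⟩ := Part.mem_bind_iff.1 hy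
    obtain ⟨s, h0, hs, rfl⟩ := ih hz
    refine ⟨fun i => if i ≤ n then s i else y, by simpa using h0, fun i hi => ?_, by simp⟩
    rcases (Nat.lt_succ_iff.1 hi).lt_or_eq with hi | rfl
    · simpa [hi.le, Nat.succ_le_of_lt hi] using hs i hi
    · simpa using hy

/-- Gödel's beta lemma is needed in `ℕ` only: the models just receive the numerals of `c` and `d`.
-/
lemma exists_beta_eq (s : ℕ → ℕ) (n : ℕ) :
    ∃ c d, ∀ i ≤ n, Nat.beta (Nat.pair c d) i = s i := by
  refine ⟨(Nat.unbeta ((List.range (n + 1)).map s)).unpair.1,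
    (Nat.unbeta ((List.range (n + 1)).map s)).unpair.2, fun i hi => ?_⟩
  have := Nat.beta_unbeta_coe ((List.range (n + 1)).map s) ⟨i, by simpa using by omega⟩
  simpa [Nat.pair_unpair] using this

section PrimitiveRecursion

variable {M : Type*} [arith.Structure M]

/-- `b` is obtained in `n` steps by primitive recursion from `F` and `H` at `a`. -/
def PrecRel (F H : M → M → Prop) (a n b : M) : Prop :=
  ∃ c d, (∃ w, F a w ∧ BetaRel c d 0 w) ∧
    (∀ j, Lt j n → ∀ w, BetaRel c d j w → ∃ r, PairRel j w r ∧ ∃ q, PairRel a r q ∧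
      ∃ w', H q w' ∧ BetaRel c d (sc j) w') ∧ BetaRel c d n b

lemma precRel_iff [Robinson M] {F H : M → M → Prop} {f h : ℕ →. ℕ}
    (hf : ∀ x y, y ∈ f x → ∀ b, F (num M x) b ↔ b = num M y)
    (hh : ∀ x y, y ∈ h x → ∀ b, H (num M x) b ↔ b = num M y) {a n y : ℕ}
    (hy : y ∈ (n.rec (f a) fun y IH => do
      let i ← IH
      h (Nat.pair a (Nat.pair y i)) : Part ℕ)) {b : M} :
    PrecRel F H (num M a) (num M n) b ↔ b = num M y := by
  obtain ⟨s, h0, hs, rfl⟩ := exists_seq_of_mem_rec hy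
  constructor
  · rintro ⟨c, d, ⟨w, hw, hw0⟩, hstep, hb⟩
    -- As `c` and `d` may be nonstandard, the induction runs outside the model, over standard
    -- indices. The universal quantifier over `w` in `PrecRel` lets the step be used at the numeral
    -- of `s i` without first knowing that the coded value is unique.
    have key : ∀ i ≤ n, BetaRel c d (num M i) (num M (s i)) := by
      intro i
      induction i with
      | zero => exact fun _ => (hf _ _ h0 _).1 hw ▸ hw0
      | succ i ih =>
        intro hi
        obtain ⟨r, hr, q, hq, w', hw', hb'⟩ :=
          hstep (num M i) (num_lt_num.2 hi) _ (ih (Nat.le_of_succ_le hi))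
        rw [pairRel_iff] at hr
        subst hr
        rw [pairRel_iff] at hq
        subst hq
        rw [hh _ _ (hs i hi)] at hw'
        exact hw' ▸ hb'
    -- Both `b` and the numeral of `s n` are least remainders at index `n`, so they coincide.
    exact (isMinOf_unique (key n le_rfl)).1 hb
  · rintro rfl
    obtain ⟨c, d, hcd⟩ := exists_beta_eq s n
    refine ⟨num M c, num M d, ⟨num M (s 0), (hf _ _ h0 _).2 rfl, ?_⟩, fun j hj w hw => ?_, ?_⟩
    · exact (betaRel_iff (i := 0)).2 (by rw [hcd 0 (Nat.zero_le _)])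
    · obtain ⟨j, hjn, rfl⟩ := lt_num.1 hj
      rw [betaRel_iff, hcd j hjn.le] at hw
      subst hw
      refine ⟨_, pairRel_iff.2 rfl, _, pairRel_iff.2 rfl, _, (hh _ _ (hs j hjn) _).2 rfl, ?_⟩
      exact (betaRel_iff (i := j + 1)).2 (by rw [hcd _ hjn])
    · exact betaRel_iff.2 (by rw [hcd n le_rfl])

end PrimitiveRecursion

/-! ### Closure of representability under the recursion schemes. -/

section Representability

variable (L : FirstOrder.Language.{u, v}) {I : Type*} (𝓜 : I → Type*) [∀ i, L.Structure (𝓜 i)]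
  [∀ i, arith.Structure (𝓜 i)]

/-- A single formula of `L` represents `f` in every one of the structures `𝓜 i`. -/
def UnifRepr (f : ℕ →. ℕ) : Prop :=
  ∃ R : ∀ i, 𝓜 i → 𝓜 i → Prop, (UnifDef L fun i (v : Fin 2 → 𝓜 i) => R i (v 0) (v 1)) ∧
    ∀ i x y, y ∈ f x → ∀ b, R i (num (𝓜 i) x) b ↔ b = num (𝓜 i) y

variable {L 𝓜}

namespace UnifRepr

variable {f h : ℕ →. ℕ}

/-- `H` forces the intermediate value to be a numeral, so the behaviour of `F` at nonstandard inputs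
is irrelevant. -/
lemma comp (hf : UnifRepr L 𝓜 f) (hh : UnifRepr L 𝓜 h) :
    UnifRepr L 𝓜 fun n => h n >>= f := by
  obtain ⟨F, hF, hf⟩ := hf
  obtain ⟨H, hH, hh⟩ := hh
  refine ⟨fun i a b => ∃ c, H i a c ∧ F i c b,
    .exists' (.and (hH.subst₂ (.var _) (.var _)) (hF.subst₂ (.var _) (.var _))),
    fun i x y hy b => ?_⟩
  obtain ⟨c, hc, hy⟩ := Part.mem_bind_iff.1 hy
  simp [hh i x c hc, hf i c y hy]

variable (ι : arith →ᴸ L) [∀ i, ι.IsExpansionOn (𝓜 i)]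

include ι

lemma zero : UnifRepr L 𝓜 fun _ => 0 := by
  refine ⟨fun i _ b => b = 0, .eq (.var _) (.zero ι), fun i x y hy b => ?_⟩
  rw [Part.mem_some_iff.1 hy, num]

lemma succ : UnifRepr L 𝓜 Nat.succ := by
  refine ⟨fun i a b => b = sc a, .eq (.var _) (.succ ι (.var _)), fun i x y hy b => ?_⟩
  rw [Part.mem_some_iff.1 hy, num]

variable [∀ i, Robinson (𝓜 i)]

lemma left : UnifRepr L 𝓜 fun n => (Nat.unpair n).1 := by
  refine ⟨fun i => LeftRel, .leftRel ι (.var _) (.var _), fun i x y hy b => ?_⟩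
  rw [Part.mem_some_iff.1 hy]
  exact leftRel_iff

lemma right : UnifRepr L 𝓜 fun n => (Nat.unpair n).2 := by
  refine ⟨fun i => RightRel, .rightRel ι (.var _) (.var _), fun i x y hy b => ?_⟩
  rw [Part.mem_some_iff.1 hy]
  exact rightRel_iff

lemma pair (hf : UnifRepr L 𝓜 f) (hh : UnifRepr L 𝓜 h) :
    UnifRepr L 𝓜 fun n => (Nat.pair <$> f n <*> h n) := by
  obtain ⟨F, hF, hf⟩ := hf
  obtain ⟨H, hH, hh⟩ := hh
  refine ⟨fun i a b => ∃ c, F i a c ∧ ∃ d, H i a d ∧ PairRel c d b,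
    .exists' (.and (hF.subst₂ (.var _) (.var _)) (.exists' (.and (hH.subst₂ (.var _) (.var _))
      (.pairRel ι (.var _) (.var _) (.var _))))), fun i x y hy b => ?_⟩
  simp only [Seq.seq, Part.map_eq_map, Part.mem_bind_iff, Part.mem_map_iff,
    exists_exists_and_eq_and] at hy
  obtain ⟨c, hc, d, hd, rfl⟩ := hy
  simp [hf i x c hc, hh i x d hd, pairRel_iff]

/-- Below the result, `f` is defined and nonzero, so `F` refutes the output `0` there. Everything
above the result, nonstandard elements included, is excluded by minimality. -/
lemma rfind (hf : UnifRepr L 𝓜 f) :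
    UnifRepr L 𝓜 fun a => Nat.rfind fun n => (fun m => m = 0) <$> f (Nat.pair a n) := by
  obtain ⟨F, hF, hf⟩ := hf
  refine ⟨fun i a b => IsMinOf (fun n => ∃ p, PairRel a n p ∧ F i p 0) b,
    .isMinOf ι (.exists' (.and (.pairRel ι (.var _) (.var _) (.var _))
      (hF.subst₂ (.var _) (.zero ι)))) (.var _), fun i x y hy b => ?_⟩
  obtain ⟨h0, hlt⟩ := Nat.mem_rfind.1 hy
  simp only [Part.map_eq_map, Part.mem_map_iff] at h0 hlt
  obtain ⟨m, hm, h0⟩ := h0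
  obtain rfl : m = 0 := by simpa using h0
  refine isMinOf_iff ?_ fun k hk => ?_
  · simp only [pairRel_iff, exists_eq_left, hf i _ _ hm]
    rfl
  · obtain ⟨m, hm, h0⟩ := hlt hk
    simp only [pairRel_iff, exists_eq_left, hf i _ _ hm]
    exact fun h => of_decide_eq_false h0 (num_injective (M := 𝓜 i) h.symm)

lemma prec (hf : UnifRepr L 𝓜 f) (hh : UnifRepr L 𝓜 h) :
    UnifRepr L 𝓜 fun p =>
        let (a, n) := Nat.unpair p
        (n.rec (f a) fun y IH => do
          let i ← IH
          h (Nat.pair a (Nat.pair y i)) : Part ℕ) := by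
  obtain ⟨F, hF, hf⟩ := hf
  obtain ⟨H, hH, hh⟩ := hh
  refine ⟨fun i p b => ∃ a, LeftRel p a ∧ ∃ n, RightRel p n ∧ PrecRel (F i) (H i) a n b,
    ?_, fun i p y hy b => ?_⟩
  · refine .exists' (.and (.leftRel ι (.var _) (.var _)) (.exists' (.and
      (.rightRel ι (.var _) (.var _)) (.exists' (.exists' (.and (.exists' (.and
        (hF.subst₂ (.var _) (.var _)) (.betaRel ι (.var _) (.var _) (.zero ι) (.var _))))
      (.and (.forall' (.imp (.lt ι (.var _) (.var _)) (.forall' (.imp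
        (.betaRel ι (.var _) (.var _) (.var _) (.var _)) (.exists' (.and
        (.pairRel ι (.var _) (.var _) (.var _)) (.exists' (.and
        (.pairRel ι (.var _) (.var _) (.var _)) (.exists' (.and (hH.subst₂ (.var _) (.var _))
        (.betaRel ι (.var _) (.var _) (.succ ι (.var _)) (.var _))))))))))))
      (.betaRel ι (.var _) (.var _) (.var _) (.var _)))))))))
  · simp only [leftRel_iff, rightRel_iff, exists_eq_left]
    exact precRel_iff (hf i) (hh i) hy

/-- Functions that are recursive in represented oracles are represented. -/
theorem of_recursiveIn {O : Set (ℕ →. ℕ)} (hO : ∀ g ∈ O, UnifRepr L 𝓜 g)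
    (hf : Nat.RecursiveIn O f) : UnifRepr L 𝓜 f := by
  induction hf with
  | zero => exact zero ι
  | succ => exact succ ι
  | left => exact left ι
  | right => exact right ι
  | oracle g hg => exact hO g hg
  | pair _ _ ih₁ ih₂ => exact pair ι ih₁ ih₂
  | comp _ _ ih₁ ih₂ => exact comp ih₁ ih₂
  | prec _ _ ih₁ ih₂ => exact prec ι ih₁ ih₂
  | rfind _ ih => exact rfind ι ih

/-- The case of no oracles, which supplies the coding of tuples. -/
lemma of_primrec {f : ℕ → ℕ} (hf : Primrec f) : UnifRepr L 𝓜 fun n => Part.some (f n) :=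
  of_recursiveIn ι (O := ∅) (fun _ h => h.elim)
    (Nat.Primrec.recursiveIn (Primrec.nat_iff.1 hf))

end UnifRepr

end Representability

/-! ### Passage between tuples and their codes. -/

section Tuples

/-- The decoding of tuples that belongs to their standard primitive recursive coding. -/
def decodeTuple (k n : ℕ) : Option (Fin k → ℕ) :=
  @Encodable.decode (Fin k → ℕ) Primcodable.toEncodable n

/-- The components of the tuple coded by `n`, together with the information whether `n` codes a
tuple at all. -/
def tupleInfo (k : ℕ) (i : Option (Fin k)) (n : ℕ) : ℕ :=
  ((decodeTuple k n).map fun x => i.elim 1 x).getD 0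

lemma primrec_tupleInfo (k : ℕ) (i : Option (Fin k)) : Primrec (tupleInfo k i) := by
  have hdec : Primrec (decodeTuple k) := Primrec.decode
  refine Primrec.option_getD.comp (Primrec.option_map hdec ?_) (Primrec.const 0)
  cases i with
  | none => exact (Primrec.const 1).to₂
  | some i => exact (Primrec.fin_app.comp Primrec.snd (Primrec.const i)).to₂

/-- The value `1` at `none` separates genuine codes from the default `0`. Without it, a number
coding nothing would look like a code of the zero tuple. -/
lemma tupleInfo_eq_iff {k n : ℕ} {x : Fin k → ℕ} :
    (∀ i : Option (Fin k), tupleInfo k i n = i.elim 1 x) ↔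
      decodeTuple k n = some x := by
  constructor
  · intro h
    cases hd : decodeTuple k n with
    | none => simpa [tupleInfo, hd] using h none
    | some y =>
      refine congrArg some (funext fun i => ?_)
      simpa [tupleInfo, hd] using h (some i)
  · intro h i
    simp [tupleInfo, h]

variable (L : FirstOrder.Language.{u, v}) {I : Type*} (𝓜 : I → Type*) [∀ i, L.Structure (𝓜 i)]
  [∀ i, arith.Structure (𝓜 i)] {k : ℕ}

/-- A single formula of `L` represents the `k`-ary function `f` in all the structures `𝓜 i`. -/
def UnifReprTuple (f : (Fin k → ℕ) →. ℕ) : Prop :=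
  ∃ R : ∀ i, (Fin (k + 1) → 𝓜 i) → Prop, UnifDef L R ∧ ∀ i x y, y ∈ f x →
    ∀ b, R i (Fin.snoc (α := fun _ => 𝓜 i) (fun j => num (𝓜 i) (x j)) b) ↔ b = num (𝓜 i) y

variable {L 𝓜} (ι : arith →ᴸ L) [∀ i, ι.IsExpansionOn (𝓜 i)] [∀ i, Robinson (𝓜 i)]

include ι

/-- `C` is the finite conjunction of the formulas representing the components. At a numeral code it
forces every entry of `v` to be a numeral, although `v` ranges over all tuples of the model. -/
lemma exists_unifDef_tuple (k : ℕ) :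
    ∃ C : ∀ i, 𝓜 i → (Fin k → 𝓜 i) → Prop,
      (UnifDef L fun i (w : Option (Fin k) → 𝓜 i) => C i (w none) fun j => w (some j)) ∧
      ∀ i n v, C i (num (𝓜 i) n) v ↔ ∃ x, decodeTuple k n = some x ∧
        v = fun j => num (𝓜 i) (x j) := by
  choose R hR hRf using fun j => UnifRepr.of_primrec (𝓜 := 𝓜) ι (primrec_tupleInfo k j)
  refine ⟨fun i n v => ∀ j : Option (Fin k), R j i n (j.elim (num (𝓜 i) 1) v),
    .forall_fin fun j => ?_, fun i n v => ?_⟩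
  · refine (hR j).subst₂ (.var _) ?_
    cases j with
    | none => exact .num ι 1
    | some j => exact .var _
  · simp only [hRf _ i n _ (Part.mem_some _), ← tupleInfo_eq_iff]
    constructor
    · intro h
      have h0 : tupleInfo k none n = 1 := num_injective (h none).symm
      exact ⟨fun j => tupleInfo k (some j) n, Option.rec h0 fun j => rfl,
        funext fun j => h (some j)⟩
    · rintro ⟨x, hx, rfl⟩ (_ | j)
      · rw [hx none]; rfl
      · rw [hx (some j)]; rfl

lemma UnifReprTuple.oracleOf {g : (Fin k → ℕ) →. ℕ} (hg : UnifReprTuple L 𝓜 g) :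
    UnifRepr L 𝓜 (oracleOf g) := by
  obtain ⟨C, hC, hCf⟩ := exists_unifDef_tuple (𝓜 := 𝓜) ι k
  obtain ⟨G, hG, hGf⟩ := hg
  refine ⟨fun i n b => ∃ v, C i n v ∧ G i (Fin.snoc (α := fun _ => 𝓜 i) v b),
    .exists_fun (.and ?_ ?_), fun i n y hy b => ?_⟩
  · exact hC.subst (β := Fin 2 ⊕ Fin k)
      (t := fun c i w => w (c.elim (.inl 0) .inr)) fun _ => .var _
  · have := hG.subst (β := Fin 2 ⊕ Fin k)
      (t := fun c i w => w (Fin.snoc (α := fun _ => Fin 2 ⊕ Fin k) .inr (.inl 1) c))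
      fun _ => .var _
    convert this using 4 with i w
    funext c
    refine Fin.lastCases ?_ (fun c => ?_) c <;> simp
  · obtain ⟨x, hx, hy⟩ := Part.mem_bind_iff.1 hy
    have hx : decodeTuple k n = some x := Part.mem_ofOption.1 hx
    simp only [hCf, hx, Option.some.injEq]
    simp [hGf i x y hy]

/-- Here the code has to be recovered from the tuple. A nonstandard `n` might also satisfy `C`, so
the least code is taken, which is unique because it is a numeral. -/
lemma UnifReprTuple.of_unifRepr {f : (Fin k → ℕ) →. ℕ}
    (hf : UnifRepr L 𝓜 fun n => Part.bind (decodeTuple k n) fun a =>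
      (f a).map Encodable.encode) : UnifReprTuple L 𝓜 f := by
  obtain ⟨C, hC, hCf⟩ := exists_unifDef_tuple (𝓜 := 𝓜) ι k
  obtain ⟨F, hF, hFf⟩ := hf
  refine ⟨fun i v => ∃ n, IsMinOf (fun n => C i n fun j => v j.castSucc) n ∧ F i n (v (Fin.last k)),
    .exists' (.and (.isMinOf ι ?_ (.var _)) (hF.subst₂ (.var _) (.var _))), fun i x y hy b => ?_⟩
  · exact hC.subst (β := (Fin (k + 1) ⊕ Unit) ⊕ Unit)
      (t := fun c i w => w (c.elim (.inr ()) fun j => .inl (.inl j.castSucc)))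
      fun _ => .var _
  · have hex : ∃ n, decodeTuple k n = some x :=
      ⟨_, @Encodable.encodek _ Primcodable.toEncodable x⟩
    have hmin : ∀ n, IsMinOf (fun n => C i n fun j => num (𝓜 i) (x j)) n ↔
        n = num (𝓜 i) (Nat.find hex) := by
      refine fun n => isMinOf_iff (P := fun n => C i n fun j => num (𝓜 i) (x j)) ((hCf i _ _).2 ⟨x, Nat.find_spec hex, rfl⟩) fun m hm h => ?_
      obtain ⟨z, hz, hzx⟩ := (hCf _ _ _).1 h
      obtain rfl : x = z := funext fun j => num_injective (congrFun hzx j)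
      exact Nat.find_min hex hm hz
    have hmem : y ∈ Part.bind (decodeTuple k (Nat.find hex)) fun a =>
        (f a).map Encodable.encode := by
      rw [Nat.find_spec hex]
      simpa using hy
    simp only [Fin.snoc_castSucc, Fin.snoc_last, hmin, exists_eq_left, hFf i _ _ hmem]

end Tuples

/-! ### From theories to their models. -/

section Theories

variable {L : FirstOrder.Language.{u, v}} {ι : arith →ᴸ L} {T : L.Theory} {k : ℕ}
  [∀ M : T.ModelType, arith.Structure M] [∀ M : T.ModelType, ι.IsExpansionOn M]

lemma robinson_of_extendsQ (hQ : ExtendsQ ι T) (M : T.ModelType) : Robinson M := by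
  refine robinson_of_models ((Theory.model_iff _).2 fun A hA => ?_)
  rw [← LHom.realize_onSentence M ι]
  exact Theory.realize_sentence_of_mem T
    (hQ ⟨A, Theory.models_sentence_of_mem hA, rfl⟩)

/-- Closure of `T` turns membership into truth in all models. In one model, unique existence
together with the instance at the numeral of `y` says that this numeral is the only solution. -/
lemma represents_iff (hT : IsClosedTheory T) {f : (Fin k → ℕ) →. ℕ} :
    Represents ι T f ↔
      UnifReprTuple L (fun M : Theory.ModelType.{u, v, max u v} T => M) f := by
  have key (M : Theory.ModelType.{u, v, max u v} T) (ρ : L.Formula (Fin (k + 1)))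
      (x : Fin k → ℕ) (y : ℕ) : M ⊨
        ((Formula.iExsUnique Unit
        (ρ.subst (Fin.snoc (α := fun _ => L.Term (Empty ⊕ Unit))
          (fun i => ι.onTerm (numeral (x i))) (Term.var (Sum.inr ())))) ⊓
      ρ.subst (Fin.snoc (α := fun _ => L.Term Empty)
        (fun i => ι.onTerm (numeral (x i))) (ι.onTerm (numeral y))) : L.Sentence)) ↔
      ∀ b, ρ.Realize (Fin.snoc (α := fun _ => M) (fun j => num M (x j)) b) ↔ b = num M y := by
    have hsnoc {β : Type} (v : β → M) (t : L.Term β) :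
        Formula.Realize (ρ.subst
          (Fin.snoc (α := fun _ => L.Term β) (fun i => ι.onTerm (numeral (x i))) t)) v ↔
          ρ.Realize (Fin.snoc (α := fun _ => M) (fun j => num M (x j)) (t.realize v)) := by
      refine BoundedFormula.realize_subst.trans
        (iff_of_eq (congrArg (fun w => Formula.Realize ρ w) ?_))
      funext c
      refine Fin.lastCases ?_ (fun c => ?_) c
      · simp
      · simp [LHom.realize_onTerm, realize_numeral]
    rw [Sentence.Realize, Formula.realize_inf, Formula.realize_iExsUnique]
    simp only [hsnoc, Term.realize_var, Sum.elim_inr, LHom.realize_onTerm, realize_numeral]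
    constructor
    · rintro ⟨⟨c, hc, huniq⟩, hy⟩ b
      refine ⟨fun hb => ?_, fun hb => hb ▸ hy⟩
      exact congrFun ((huniq (fun _ => b) hb).trans (huniq (fun _ => num M y) hy).symm) ()
    · intro h
      exact ⟨⟨fun _ => num M y, (h _).2 rfl, fun c hc => funext fun _ => (h _).1 hc⟩, (h _).2 rfl⟩
  have mem_iff (A : L.Sentence) : A ∈ T ↔ ∀ M : Theory.ModelType.{u, v, max u v} T, M ⊨ A :=
    ⟨fun h _ => Theory.realize_sentence_of_mem T h,
      fun h => hT A (Theory.models_sentence_iff.2 h)⟩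
  simp only [Represents, RepresentedBy, mem_iff, key]
  constructor
  · rintro ⟨ρ, h⟩
    exact ⟨fun M v => ρ.Realize v, ⟨ρ, fun _ _ => Iff.rfl⟩, fun M x y hy => h x y hy M⟩
  · rintro ⟨R, ⟨ρ, hρ⟩, h⟩
    exact ⟨ρ, fun x y hy M b => (hρ M _).trans (h M x y hy b)⟩

end Theories

end OracleRep

theorem mainTheorem10 {L : FirstOrder.Language.{u, v}} (ι : OracleRep.arith →ᴸ L)
    (T : L.Theory) (hT : OracleRep.IsClosedTheory T) (hQ : OracleRep.ExtendsQ ι T)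
    {m : ℕ} (g : (Fin m → ℕ) →. ℕ) (hg : OracleRep.Represents ι T g)
    {k : ℕ} (f : (Fin k → ℕ) →. ℕ) (hf : OracleRep.ComputableWithOracle f g) :
    OracleRep.Represents ι T f := by
  let (M : Theory.ModelType.{u, v, max u v} T) : OracleRep.arith.Structure M := ι.reduct M
  have (M : Theory.ModelType.{u, v, max u v} T) : OracleRep.Robinson M :=
    OracleRep.robinson_of_extendsQ hQ M
  rw [OracleRep.represents_iff hT] at hg ⊢
  refine .of_unifRepr ι (.of_recursiveIn ι (O := {OracleRep.oracleOf g}) ?_ hf)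
  rintro _ rfl
  exact hg.oracleOf ι
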